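/- Let $n\ge 2$. On $L^2(\mathbb R^n)$ let $\hat x_j f(x)=x_jf(x)$ and $\hat p_j f=-{\rm i}\,\partial_{x_j} f$ ($1\le j\le n$) be the position and momentum operators of $n$ quantum harmonic oscillators, and define the Jordan–Schwinger operators $$\hat H_i=\tfrac12\left(\hat x_i^2+\hat p_i^2-\hat x_{i+1}^2-\hat p_{i+1}^2\right),\qquad \hat S_{j,k}=\tfrac12\left(\hat x_j\hat x_k+\hat p_j\hat p_k\right),\qquad \hat A_{j,k}=\tfrac12\left(\hat p_j\hat x_k-\hat x_j\hat p_k\right),$$ for $1\le i\le n-1$ and $1\le j<k\le n$. These operators, as well as the operators $\hat x_j^2$, $\hat p_j^2$ ($1\le j\le n$) and $\hat x_j\hat x_k$, $\hat p_j\hat p_k$, $\hat x_j\hat p_k$, $\hat p_j\hat x_k$ ($1\le j<k\le n$), are defined on the Schwartz functions; the closure of each of them generates a unique strongly continuous one-parameter unitary group on $L^2(\mathbb R^n)$, and $e^{{\rm i}t\hat O}$ denotes the element at time $t\in\mathbb R$ of the group generated by (the closure of) $\hat O$. Let $\varsigma,\vartheta,\varphi\in[-\pi/2,\pi/2]$.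 Then for all $1\le i\le n-1$ and $1\le j<k\le n$, as equalities of unitary operators on $L^2(\mathbb R^n)$, $$e^{{\rm i}\varsigma\hat H_i}=e^{{\rm i}\varsigma_1\hat p_i^2}\,e^{{\rm i}\varsigma_2\hat x_i^2}\,e^{{\rm i}\varsigma_1\hat p_i^2}\,e^{-{\rm i}\varsigma_1\hat p_{i+1}^2}\,e^{-{\rm i}\varsigma_2\hat x_{i+1}^2}\,e^{-{\rm i}\varsigma_1\hat p_{i+1}^2},$$ $$e^{{\rm i}\vartheta\hat S_{j,k}}=e^{{\rm i}\vartheta_1\hat p_j\hat p_k}\,e^{{\rm i}\vartheta_2\hat x_j\hat x_k}\,e^{{\rm i}\vartheta_1\hat p_j\hat p_k},$$ $$e^{{\rm i}\varphi\hat A_{j,k}}=e^{-{\rm i}\varphi_1\hat x_j\hat p_k}\,e^{{\rm i}\varphi_2\hat p_j\hat x_k}\,e^{-{\rm i}\varphi_1\hat x_j\hat p_k},$$ where $\varsigma_1=\tfrac12\tan(\varsigma/2)$, $\varsigma_2=\tfrac12\sin\varsigma$, $\vartheta_1=\tan(\vartheta/4)$, $\vartheta_2=\sin(\vartheta/2)$,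 $\varphi_1=\tan(\varphi/4)$ and $\varphi_2=\sin(\varphi/2)$. -/

import Mathlib

open MeasureTheory
open scoped SchwartzMap LineDeriv

namespace Oscillator

noncomputable section

/-- The configuration space `ℝⁿ` of `n` one-dimensional oscillators. -/
abbrev Config (n : ℕ) : Type := EuclideanSpace ℝ (Fin n)

/-- Complex-valued Schwartz functions on `ℝⁿ`: the common invariant domain on which the position
and momentum operators and their polynomials are defined. -/
abbrev Schw (n : ℕ) : Type := 𝓢(Config n, ℂ)

/-- The Hilbert space `L²(ℝⁿ; ℂ)` of `n` quantum harmonic oscillators. -/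
abbrev Hilb (n : ℕ) : Type := Lp ℂ 2 (volume : Measure (Config n))

variable {n : ℕ}

/-- Position operator of mode `j` : `(x̂ⱼ f)(x) = xⱼ f(x)`. -/
def posOp (j : Fin n) : Schw n →L[ℂ] Schw n :=
  SchwartzMap.smulLeftCLM ℂ (fun x : Config n => ((x j : ℝ) : ℂ))

/-- Momentum operator of mode `j` : `p̂ⱼ f = -i ∂ⱼ f`. -/
def momOp (j : Fin n) : Schw n →L[ℂ] Schw n :=
  (-Complex.I) • LineDeriv.lineDerivOpCLM ℂ (Schw n) (EuclideanSpace.single j (1 : ℝ))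

theorem posOp_apply (j : Fin n) (f : Schw n) (x : Config n) :
    posOp j f x = ((x j : ℝ) : ℂ) * f x := by
  have h : Function.HasTemperateGrowth (fun x : Config n => ((x j : ℝ) : ℂ)) :=
    (Complex.ofRealCLM.comp (EuclideanSpace.proj j : Config n →L[ℝ] ℝ)).hasTemperateGrowth
  simp [posOp, SchwartzMap.smulLeftCLM_apply_apply h]

theorem momOp_apply (j : Fin n) (f : Schw n) (x : Config n) :
    momOp j f x = -Complex.I * lineDeriv ℝ (fun y => f y) x (EuclideanSpace.single j (1 : ℝ)) := by
  simp [momOp, SchwartzMap.lineDerivOp_apply]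

/-- `Ĥ = ½ (x̂ᵢ² + p̂ᵢ² - x̂ᵢ₊₁² - p̂ᵢ₊₁²)`, for the two modes `i` and `i' = i + 1`. -/
def opH (i i' : Fin n) : Schw n →L[ℂ] Schw n :=
  (1 / 2 : ℂ) • (posOp i ∘L posOp i + momOp i ∘L momOp i
    - posOp i' ∘L posOp i' - momOp i' ∘L momOp i')

/-- `Ŝⱼₖ = ½ (x̂ⱼ x̂ₖ + p̂ⱼ p̂ₖ)`. -/
def opS (j k : Fin n) : Schw n →L[ℂ] Schw n :=
  (1 / 2 : ℂ) • (posOp j ∘L posOp k + momOp j ∘L momOp k)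

/-- `Âⱼₖ = ½ (p̂ⱼ x̂ₖ - x̂ⱼ p̂ₖ)`. -/
def opA (j k : Fin n) : Schw n →L[ℂ] Schw n :=
  (1 / 2 : ℂ) • (momOp j ∘L posOp k - posOp j ∘L momOp k)

/-- The graph in `L²(ℝⁿ) × L²(ℝⁿ)` of the operator `T` with domain the Schwartz functions. -/
def schwartzGraph (T : Schw n →L[ℂ] Schw n) : Submodule ℂ (Hilb n × Hilb n) :=
  LinearMap.range
    ((SchwartzMap.toLpCLM ℂ ℂ 2 (volume : Measure (Config n))).toLinearMap.prod
      ((SchwartzMap.toLpCLM ℂ ℂ 2 (volume : Measure (Config n))).toLinearMap ∘ₗ T.toLinearMap))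

/-- `U` is the strongly continuous one-parameter unitary group `t ↦ e^{i t T̄}`, where `T̄` is the
closure in `L²(ℝⁿ)` of the operator `T` on Schwartz functions: `f` lies in the domain of `T̄` and
`T̄ f = g` exactly when `t ↦ U t f` has derivative `i g` at `t = 0`. -/
structure IsExpGroup (T : Schw n →L[ℂ] Schw n) (U : ℝ → Hilb n →L[ℂ] Hilb n) : Prop where
  map_zero : U 0 = ContinuousLinearMap.id ℂ (Hilb n)
  map_add : ∀ s t : ℝ, U (s + t) = U s ∘L U t
  norm_map : ∀ (t : ℝ) (f : Hilb n), ‖U t f‖ = ‖f‖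
  continuous : ∀ f : Hilb n, Continuous fun t => U t f
  generator : ∀ f g : Hilb n, HasDerivAt (fun t => U t f) (Complex.I • g) 0 ↔
    (f, g) ∈ (schwartzGraph T).topologicalClosure

/-- The exponentials `e^{i t T}`, `t : ℝ`, are well defined: there is exactly one strongly
continuous unitary group generated by the closure of `T`. (By Stone's theorem this says that `T`
is essentially self-adjoint on the Schwartz functions.) -/
def HasExp (T : Schw n →L[ℂ] Schw n) : Prop := ∃! U : ℝ → Hilb n →L[ℂ] Hilb n, IsExpGroup T U

open Classical in
/-- `expI t T` is the unitary `e^{i t T}` on `L²(ℝⁿ)` (with the value `0` if not `HasExp T`). -/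
def expI (t : ℝ) (T : Schw n →L[ℂ] Schw n) : Hilb n →L[ℂ] Hilb n :=
  if h : HasExp T then h.choose t else 0

end

end Oscillator

/-
For vectors `u`, `v` with `⟪u, v⟫ = 0` and `‖u‖ ‖v‖ = 1`, the quadratic operators `E = x_u x_v`
and `F = p_u p_v` span, together with their commutator, a copy of `sl₂`, and their groups
`B t = e^{i t E}` and `A t = e^{i t F}` (a chirp and its Fourier conjugate) act on it as the two
unipotent subgroups of `SL₂`. By this action
`W t = A (tan (t / 4)) * B (sin (t / 2)) * A (tan (t / 4))` solves `W' = i T W` with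
`T = (E + F) / 2` as long as `|t| < 2 π`; it is the decomposition of a rotation into three
shears. Uniqueness for this equation makes `W` a local one-parameter group of isometries of the
Schwartz space, which extends to all times. A densely defined operator with such an invariant flow
is essentially self-adjoint, so the extension of `W` to `L²` is generated by the closure of `T`.

For orthonormal directions `e`, `e'`, the operator `Ŝ` is the case `u = e`, `v = e'`. The operator
`Â` is its conjugate by the quarter turn `x_e ↦ p_e ↦ -x_e`. Finally `Ĥ` is twice the case
`u = e - e'`, `v = (e + e') / 2`, because `x_u x_v = (x_e² - x_{e'}²) / 2`.
-/

namespace Oscillator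

section LocalHom

variable {M : Type*} [Monoid M] {W : ℝ → M} {δ : ℝ}

theorem pow_two_pow_eq_of_local_add
    (hW : ∀ s t, |s| < δ → |t| < δ → |s + t| < δ → W (s + t) = W s * W t) {t : ℝ} (k m : ℕ)
    (ht : |t / 2 ^ k| < δ) : W (t / 2 ^ (k + m)) ^ 2 ^ (k + m) = W (t / 2 ^ k) ^ 2 ^ k := by
  induction m with
  | zero => rfl
  | succ m ih =>
    set s := t / 2 ^ (k + (m + 1)) with hs
    have hdouble : t / 2 ^ (k + m) = s + s := by rw [hs]; field_simp; ring
    have hlarge : |s + s| < δ := by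
      refine lt_of_le_of_lt ?_ ht
      rw [← hdouble, abs_div, abs_div]
      gcongr <;> simp
    have hsmall : |s| < δ := by
      have h2 : |s + s| = 2 * |s| := by rw [← two_mul, abs_mul, abs_two]
      linarith [abs_nonneg s]
    rw [← ih, hdouble, hW s s hsmall hsmall hlarge, ← pow_two, ← pow_mul, ← pow_succ', add_assoc]

theorem exists_map_add_extension (hδ : 0 < δ)
    (hW : ∀ s t, |s| < δ → |t| < δ → |s + t| < δ → W (s + t) = W s * W t) :
    ∃ u : ℝ → M, (∀ s t, u (s + t) = u s * u t) ∧ (∀ t, |t| < δ → u t = W t) ∧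
      ∀ t, ∃ s m, |s| < δ ∧ u t = W s ^ m := by
  have hsmall (t : ℝ) : ∃ k : ℕ, |t / 2 ^ k| < δ := by
    obtain ⟨k, hk⟩ := pow_unbounded_of_one_lt (|t| / δ) one_lt_two
    exact ⟨k, by rwa [abs_div, abs_of_pos (by positivity : (0 : ℝ) < 2 ^ k),
      div_lt_comm₀ (by positivity) hδ]⟩
  choose κ hκ using hsmall
  let u (t : ℝ) : M := W (t / 2 ^ κ t) ^ 2 ^ κ t
  have hu (t : ℝ) (k : ℕ) (hk : |t / 2 ^ k| < δ) : u t = W (t / 2 ^ k) ^ 2 ^ k := by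
    rw [← pow_two_pow_eq_of_local_add hW k (κ t) hk, add_comm,
      pow_two_pow_eq_of_local_add hW (κ t) k (hκ t)]
  have hmono (t : ℝ) {k : ℕ} (hk : κ t ≤ k) : |t / 2 ^ k| < δ := by
    refine lt_of_le_of_lt ?_ (hκ t)
    rw [abs_div, abs_div, abs_pow, abs_pow, abs_two]
    gcongr
    exact one_le_two
  refine ⟨u, fun s t => ?_, fun t ht => by simpa using hu t 0 (by simpa using ht),
    fun t => ⟨_, _, hκ t, rfl⟩⟩
  set k := κ s + κ t + κ (s + t)
  have hs := hmono s (show κ s ≤ k by omega)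
  have ht := hmono t (show κ t ≤ k by omega)
  have hst := hmono (s + t) (show κ (s + t) ≤ k by omega)
  have hcomm : Commute (W (s / 2 ^ k)) (W (t / 2 ^ k)) := by
    rw [add_div] at hst
    rw [commute_iff_eq, ← hW _ _ hs ht hst, add_comm, hW _ _ ht hs (by rwa [add_comm])]
  rw [hu _ k hst, hu s k hs, hu t k ht, ← hcomm.mul_pow, add_div,
    hW _ _ hs ht (by rwa [← add_div])]

end LocalHom

section SymmetricRelation

variable {H : Type*} [NormedAddCommGroup H] [InnerProductSpace ℂ H]

/-- A linear relation on an inner product space, such as the graph of an unbounded operator `T`, is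
symmetric if `⟪T f, g⟫ = ⟪f, T g⟫` on it. -/
def IsSymmetricRel (G : Submodule ℂ (H × H)) : Prop :=
  ∀ p ∈ G, ∀ q ∈ G, inner ℂ p.2 q.1 = inner ℂ p.1 q.2

theorem IsSymmetricRel.norm_sq_add_I_smul {G : Submodule ℂ (H × H)} (hG : IsSymmetricRel G)
    {p : H × H} (hp : p ∈ G) : ‖p.2 + Complex.I • p.1‖ ^ 2 = ‖p.2‖ ^ 2 + ‖p.1‖ ^ 2 := by
  have him : (inner ℂ p.2 p.1).im = 0 := by
    rw [← Complex.conj_eq_iff_im, inner_conj_symm, hG p hp p hp]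
  rw [norm_add_sq (𝕜 := ℂ), inner_smul_right, norm_smul]
  simp [him]

/-- Since `‖(T + i) f‖² = ‖T f‖² + ‖f‖²` for a symmetric operator `T`, approximating `(T + i) f`
amounts to approximating both `f` and `T f`. -/
theorem IsSymmetricRel.le_topologicalClosure {G G' : Submodule ℂ (H × H)} (hG : IsSymmetricRel G)
    (hle : G' ≤ G) (hdense : Dense ((fun p : H × H => p.2 + Complex.I • p.1) '' G')) :
    G ≤ G'.topologicalClosure := by
  intro p hp
  rw [← SetLike.mem_coe, Submodule.topologicalClosure_coe, Metric.mem_closure_iff]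
  intro ε hε
  obtain ⟨_, ⟨q, hq, rfl⟩, hpq⟩ :=
    Metric.mem_closure_iff.1 (hdense (p.2 + Complex.I • p.1)) ε hε
  have hnorm := hG.norm_sq_add_I_smul (G.sub_mem hp (hle hq))
  have hlt : ‖(p - q).2 + Complex.I • (p - q).1‖ < ε := by
    rwa [Prod.fst_sub, Prod.snd_sub, smul_sub, sub_add_sub_comm, ← dist_eq_norm]
  refine ⟨q, hq, ?_⟩
  rw [dist_eq_norm, Prod.norm_def, max_lt_iff]
  constructor <;> refine lt_of_le_of_lt (le_of_sq_le_sq ?_ (norm_nonneg _)) hlt <;>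
    rw [hnorm] <;> simp

theorem inner_map_map_of_norm_eq {D : Type*} [AddCommGroup D] [Module ℂ D] {φ ψ : D →ₗ[ℂ] H}
    (h : ∀ f, ‖φ f‖ = ‖ψ f‖) (f g : D) : inner ℂ (φ f) (φ g) = inner ℂ (ψ f) (ψ g) := by
  simp only [inner_eq_sum_norm_sq_div_four, ← map_smul, ← map_add, ← map_sub, h]

variable [NormedSpace ℝ H]

theorem inner_eq_inner_of_hasDerivAt {y z : ℝ → H} {y' z' : H} {t : ℝ} {c : ℂ}
    (hy : HasDerivAt y (Complex.I • y') t) (hz : HasDerivAt z (Complex.I • z') t)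
    (hc : (fun s => inner ℂ (y s) (z s)) =ᶠ[nhds t] fun _ => c) :
    inner ℂ y' (z t) = inner ℂ (y t) z' := by
  have h := (hy.inner ℂ hz).unique ((hasDerivAt_const t c).congr_of_eventuallyEq hc)
  rw [inner_smul_left, inner_smul_right, Complex.conj_I, neg_mul, ← sub_eq_add_neg, ← mul_sub,
    mul_eq_zero, or_iff_right Complex.I_ne_zero] at h
  exact (sub_eq_zero.1 h).symm

theorem IsSymmetricRel.norm_eq {G : Submodule ℂ (H × H)} (hG : IsSymmetricRel G) {y g : ℝ → H}
    {s : Set ℝ} (hs : IsOpen s) (hc : IsPreconnected s)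
    (hy : ∀ t ∈ s, HasDerivAt y (Complex.I • g t) t) (hmem : ∀ t ∈ s, (y t, g t) ∈ G)
    {a b : ℝ} (ha : a ∈ s) (hb : b ∈ s) : ‖y a‖ = ‖y b‖ := by
  have hderiv : ∀ t ∈ s, HasDerivAt (fun t => inner ℂ (y t) (y t)) 0 t := fun t ht => by
    have hsymm : inner ℂ (g t) (y t) = inner ℂ (y t) (g t) := hG _ (hmem t ht) _ (hmem t ht)
    have h := (hy t ht).inner ℂ (hy t ht)
    rwa [inner_smul_left, inner_smul_right, Complex.conj_I, hsymm, neg_mul, add_neg_cancel] at h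
  have hconst := hs.is_const_of_deriv_eq_zero hc
    (fun t ht => (hderiv t ht).differentiableAt.differentiableWithinAt)
    (fun t ht => (hderiv t ht).deriv) ha hb
  rw [norm_eq_sqrt_re_inner (𝕜 := ℂ), norm_eq_sqrt_re_inner (𝕜 := ℂ) (y b), hconst]

end SymmetricRelation

section UnitaryGroup

variable {H : Type*} [NormedAddCommGroup H] [InnerProductSpace ℂ H]

/-- A strongly continuous one-parameter unitary group; surjectivity of `U t` is automatic because
`U (-t)` inverts it. -/
structure IsUnitaryGroup (U : ℝ → H →L[ℂ] H) : Prop where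
  map_zero : U 0 = ContinuousLinearMap.id ℂ H
  map_add : ∀ s t, U (s + t) = U s ∘L U t
  norm_map : ∀ t f, ‖U t f‖ = ‖f‖
  continuous : ∀ f, Continuous fun t => U t f

variable [NormedSpace ℝ H] {U V : ℝ → H →L[ℂ] H}

/-- The graph of the generator `T` of the group `U t = e^{i t T}`. -/
def generator (U : ℝ → H →L[ℂ] H) : Submodule ℂ (H × H) where
  carrier := {p | HasDerivAt (fun t => U t p.1) (Complex.I • p.2) 0}
  zero_mem' := by simpa using hasDerivAt_const (0 : ℝ) (0 : H)
  add_mem' hp hq := by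
    simpa only [Set.mem_ofPred_eq, Prod.fst_add, Prod.snd_add, map_add, smul_add] using
      hp.fun_add hq
  smul_mem' c p hp := by
    simpa only [Set.mem_ofPred_eq, Prod.smul_fst, Prod.smul_snd, map_smul, smul_comm c] using
      hp.fun_const_smul c

theorem mem_generator {p : H × H} :
    p ∈ generator U ↔ HasDerivAt (fun t => U t p.1) (Complex.I • p.2) 0 :=
  Iff.rfl

theorem hasDerivAt_map_of_mem_generator {p : H × H} (hp : p ∈ generator U) (A : H →L[ℂ] H) :
    HasDerivAt (fun s => A (U s p.1)) (Complex.I • A p.2) 0 := by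
  simpa [Function.comp_def] using
    (A.restrictScalars ℝ).hasFDerivAt.comp_hasDerivAt 0 (mem_generator.1 hp)

namespace IsUnitaryGroup

theorem hasDerivAt (hU : IsUnitaryGroup U) {p : H × H} (hp : p ∈ generator U) (t : ℝ) :
    HasDerivAt (fun s => U s p.1) (Complex.I • U t p.2) t := by
  have h := (sub_self t ▸ hasDerivAt_map_of_mem_generator hp (U t) :
    HasDerivAt (fun s => U t (U s p.1)) (Complex.I • U t p.2) (t - t)).comp_sub_const t t
  simpa only [← ContinuousLinearMap.comp_apply, ← hU.map_add, add_sub_cancel] using h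

theorem map_mem_generator (hU : IsUnitaryGroup U) {p : H × H} (hp : p ∈ generator U) (t : ℝ) :
    (U t p.1, U t p.2) ∈ generator U := by
  have h := hasDerivAt_map_of_mem_generator hp (U t)
  simp only [← ContinuousLinearMap.comp_apply, ← hU.map_add, add_comm t] at h
  simpa only [mem_generator, ← ContinuousLinearMap.comp_apply, ← hU.map_add] using h

theorem isSymmetricRel_generator (hU : IsUnitaryGroup U) : IsSymmetricRel (generator U) := by
  intro p hp q hq
  have hinner (s : ℝ) : inner ℂ (U s p.1) (U s q.1) = inner ℂ p.1 q.1 :=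
    inner_map_map_of_norm_eq (φ := (U s).toLinearMap) (ψ := LinearMap.id) (hU.norm_map s) _ _
  simpa [hU.map_zero] using inner_eq_inner_of_hasDerivAt (mem_generator.1 hp) (mem_generator.1 hq)
    (Filter.Eventually.of_forall hinner)

theorem isClosed_generator (hU : IsUnitaryGroup U) :
    IsClosed (generator U : Set (H × H)) := by
  refine IsSeqClosed.isClosed fun p q hp hpq => ?_
  have hunif : TendstoUniformly (fun k t => Complex.I • U t (p k).2)
      (fun t => Complex.I • U t q.2) Filter.atTop := by
    refine Metric.tendstoUniformly_iff.2 fun ε hε => ?_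
    filter_upwards [Metric.tendsto_nhds.1 ((continuous_snd.tendsto q).comp hpq) ε hε] with k hk t
    rwa [dist_eq_norm, ← smul_sub, ← map_sub, norm_smul, Complex.norm_I, one_mul, hU.norm_map,
      ← dist_eq_norm, dist_comm]
  have h := hasDerivAt_of_tendstoUniformly hunif
    (Filter.Eventually.of_forall fun k t => hU.hasDerivAt (hp k) t)
    (fun t => ((U t).continuous.tendsto _).comp ((continuous_fst.tendsto q).comp hpq)) 0
  simpa only [SetLike.mem_coe, mem_generator, hU.map_zero, ContinuousLinearMap.id_apply] using h

theorem eq_of_generator_eq (hU : IsUnitaryGroup U) (hV : IsUnitaryGroup V)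
    (h : generator U = generator V)
    (hdense : Dense (Prod.fst '' (generator U : Set (H × H)))) : U = V := by
  funext t
  refine ContinuousLinearMap.ext fun f => ?_
  refine Set.EqOn.of_subset_closure (s := Prod.fst '' (generator U : Set (H × H)))
    (fun f hf => ?_) (U t).continuous.continuousOn (V t).continuous.continuousOn
    (Set.subset_univ _) hdense.closure_eq.ge (Set.mem_univ f)
  obtain ⟨p, hp, rfl⟩ := hf
  have hp' : p ∈ generator V := h ▸ hp
  have hderiv (s : ℝ) :
      HasDerivAt (fun s => U s p.1 - V s p.1) (Complex.I • (U s p.2 - V s p.2)) s := by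
    simpa only [smul_sub] using (hU.hasDerivAt hp s).fun_sub (hV.hasDerivAt hp' s)
  have hmem (s : ℝ) : (U s p.1 - V s p.1, U s p.2 - V s p.2) ∈ generator U :=
    (generator U).sub_mem (hU.map_mem_generator hp s) (h ▸ hV.map_mem_generator hp' s)
  have hnorm := hU.isSymmetricRel_generator.norm_eq isOpen_univ isPreconnected_univ
    (fun s _ => hderiv s) (fun s _ => hmem s) (Set.mem_univ t) (Set.mem_univ 0)
  simpa [hU.map_zero, hV.map_zero, sub_eq_zero] using hnorm

end IsUnitaryGroup

end UnitaryGroup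

section StrongDerivative

variable {D H : Type*} [AddCommGroup D] [Module ℂ D] [NormedAddCommGroup H] [NormedSpace ℂ H]

/-- The endomorphisms of `D` that preserve the norm induced from `H` by `ι : D → H`. -/
def isometricEnd (ι : D →ₗ[ℂ] H) : Submonoid (Module.End ℂ D) where
  carrier := {V | ∀ f, ‖ι (V f)‖ = ‖ι f‖}
  one_mem' _ := rfl
  mul_mem' hV hW f := (hV _).trans (hW f)

theorem inv_mem_isometricEnd {ι : D →ₗ[ℂ] H} {V : (Module.End ℂ D)ˣ}
    (hV : (V : Module.End ℂ D) ∈ isometricEnd ι) :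
    ((V⁻¹ : (Module.End ℂ D)ˣ) : Module.End ℂ D) ∈ isometricEnd ι := fun f => by
  rw [← hV, ← Module.End.mul_apply, Units.mul_inv, Module.End.one_apply]

theorem ext_of_denseRange {ι : D →ₗ[ℂ] H} (hι : DenseRange ι) {A B : H →L[ℂ] H}
    (h : ∀ f, A (ι f) = B (ι f)) : A = B :=
  DFunLike.coe_injective (hι.equalizer A.continuous B.continuous (funext h))

variable [NormedSpace ℝ H]

/-- The derivative of a family of endomorphisms of `D` in the strong operator topology of `H`. -/
def HasStrongDerivAt (ι : D →ₗ[ℂ] H) (Y : ℝ → Module.End ℂ D) (Y' : Module.End ℂ D) (t : ℝ) :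
    Prop :=
  ∀ f, HasDerivAt (fun s => ι (Y s f)) (ι (Y' f)) t

namespace HasStrongDerivAt

variable {ι : D →ₗ[ℂ] H} {Y A B : ℝ → Module.End ℂ D} {Y' Y'' A' B' : Module.End ℂ D} {t : ℝ}

theorem unique (hι : Function.Injective ι) (h : HasStrongDerivAt ι Y Y' t)
    (h' : HasStrongDerivAt ι Y Y'' t) : Y' = Y'' :=
  LinearMap.ext fun f => hι ((h f).unique (h' f))

theorem const (V : Module.End ℂ D) : HasStrongDerivAt ι (fun _ => V) 0 t := fun f => by
  simpa using hasDerivAt_const t (ι (V f))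

theorem mul_const (h : HasStrongDerivAt ι Y Y' t) (V : Module.End ℂ D) :
    HasStrongDerivAt ι (fun s => Y s * V) (Y' * V) t :=
  fun f => h (V f)

theorem comp_add_const (a : ℝ) (h : HasStrongDerivAt ι Y Y' (t + a)) :
    HasStrongDerivAt ι (fun s => Y (s + a)) Y' t :=
  fun f => (h f).comp_add_const t a

theorem scomp {α : ℝ → ℝ} {a : ℝ} (h : HasStrongDerivAt ι Y Y' (α t)) (hα : HasDerivAt α a t) :
    HasStrongDerivAt ι (fun s => Y (α s)) ((a : ℂ) • Y') t := fun f => by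
  simpa [Function.comp_def] using (h f).scomp t hα

theorem mul (hA : HasStrongDerivAt ι A A' t) (hisom : ∀ s, A s ∈ isometricEnd ι)
    (hB : HasStrongDerivAt ι B B' t) :
    HasStrongDerivAt ι (fun s => A s * B s) (A' * B t + A t * B') t := by
  intro f
  have hmoving : HasDerivAt (fun s => ι (A s (B s f - B t f))) (ι (A t (B' f))) t := by
    have hleft : (fun s => ι (A s (B s f - B t f)) - (s - t) • ι (A s (B' f)))
        =o[nhds t] fun s => s - t := by
      refine Asymptotics.IsLittleO.congr_left (f₁ := fun s => ι (A s
        (B s f - B t f - ((s - t : ℝ) : ℂ) • B' f))) ?_ fun s => by simp [-Complex.ofReal_sub]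
      refine Asymptotics.IsLittleO.of_norm_left ?_
      simp only [hisom _ _]
      refine Asymptotics.IsLittleO.norm_left ?_
      simpa [-Complex.ofReal_sub] using hasDerivAt_iff_isLittleO.1 (hB f)
    have hright : (fun s => (s - t) • (ι (A s (B' f)) - ι (A t (B' f))))
        =o[nhds t] fun s => s - t := by
      have hcont : Filter.Tendsto (fun s => ι (A s (B' f))) (nhds t) (nhds (ι (A t (B' f)))) :=
        (hA (B' f)).continuousAt
      simpa using (Asymptotics.isBigO_refl (fun s => s - t) (nhds t)).smul_isLittleO
        ((Asymptotics.isLittleO_one_iff ℝ).2 (tendsto_sub_nhds_zero_iff.2 hcont))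
    refine hasDerivAt_iff_isLittleO.2 ((hleft.add hright).congr_left fun s => ?_)
    simp [smul_sub]
  simpa using (hA (B t f)).fun_add hmoving

end HasStrongDerivAt

end StrongDerivative

section Flow

variable {D H : Type*} [AddCommGroup D] [Module ℂ D] [NormedAddCommGroup H] [InnerProductSpace ℂ H]

/-- The graph in `H` of an operator `T` with domain `D`. -/
def domGraph (ι : D →ₗ[ℂ] H) (T : Module.End ℂ D) : Submodule ℂ (H × H) :=
  LinearMap.range (ι.prod (ι ∘ₗ T))

theorem mem_domGraph (ι : D →ₗ[ℂ] H) (T : Module.End ℂ D) (f : D) :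
    (ι f, ι (T f)) ∈ domGraph ι T :=
  ⟨f, rfl⟩

variable [NormedSpace ℝ H] {ι : D →ₗ[ℂ] H} {T : Module.End ℂ D} {W u : ℝ → Module.End ℂ D} {a : ℝ}

/-- An isometric solution of `W' = i T W`, `W 0 = 1` for times `|t| < a`, acting on the domain `D`
of `T`. -/
structure IsLocalFlow (ι : D →ₗ[ℂ] H) (T : Module.End ℂ D) (a : ℝ) (W : ℝ → Module.End ℂ D) :
    Prop where
  map_zero : W 0 = 1
  isometric : ∀ t, |t| < a → W t ∈ isometricEnd ι
  hasStrongDerivAt : ∀ t, |t| < a → HasStrongDerivAt ι W (Complex.I • (T * W t)) t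

/-- An isometric one-parameter group `u t = e^{i t T}` acting on the domain `D` of `T`. -/
structure IsFlow (ι : D →ₗ[ℂ] H) (T : Module.End ℂ D) (u : ℝ → Module.End ℂ D) : Prop where
  map_zero : u 0 = 1
  map_add : ∀ s t, u (s + t) = u s * u t
  isometric : ∀ t, u t ∈ isometricEnd ι
  hasStrongDerivAt_zero : HasStrongDerivAt ι u (Complex.I • T) 0

theorem IsLocalFlow.isSymmetricRel (hW : IsLocalFlow ι T a W) (ha : 0 < a) :
    IsSymmetricRel (domGraph ι T) := by
  rintro _ ⟨f, rfl⟩ _ ⟨g, rfl⟩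
  have hderiv (f : D) : HasDerivAt (fun s => ι (W s f)) (Complex.I • ι (T f)) 0 := by
    simpa [hW.map_zero] using hW.hasStrongDerivAt 0 (by simpa using ha) f
  have hinner : (fun s => inner ℂ (ι (W s f)) (ι (W s g))) =ᶠ[nhds 0]
      fun _ => inner ℂ (ι f) (ι g) := by
    filter_upwards [Metric.ball_mem_nhds (0 : ℝ) ha] with s hs
    exact inner_map_map_of_norm_eq (φ := ι ∘ₗ W s) (hW.isometric s (by simpa using hs)) f g
  simpa [hW.map_zero] using inner_eq_inner_of_hasDerivAt (hderiv f) (hderiv g) hinner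

theorem IsSymmetricRel.eqOn_of_hasStrongDerivAt (hT : IsSymmetricRel (domGraph ι T))
    (hι : Function.Injective ι) {Y Z : ℝ → Module.End ℂ D} {s : Set ℝ} (hs : IsOpen s)
    (hc : IsPreconnected s) (hY : ∀ t ∈ s, HasStrongDerivAt ι Y (Complex.I • (T * Y t)) t)
    (hZ : ∀ t ∈ s, HasStrongDerivAt ι Z (Complex.I • (T * Z t)) t) {t₀ : ℝ} (ht₀ : t₀ ∈ s)
    (h₀ : Y t₀ = Z t₀) : Set.EqOn Y Z s := by
  refine fun t ht => LinearMap.ext fun f => hι (sub_eq_zero.1 (norm_eq_zero.1 ?_))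
  have hnorm := hT.norm_eq (y := fun t => ι (Y t f) - ι (Z t f))
    (g := fun t => ι (T (Y t f)) - ι (T (Z t f))) hs hc
    (fun t ht => by simpa [smul_sub] using (hY t ht f).fun_sub (hZ t ht f))
    (fun t _ => (domGraph ι T).sub_mem (mem_domGraph ι T (Y t f)) (mem_domGraph ι T (Z t f)))
    ht ht₀
  simpa [h₀] using hnorm

theorem IsLocalFlow.map_add (hW : IsLocalFlow ι T a W) (hι : Function.Injective ι) {s t : ℝ}
    (hs : |s| < a) (ht : |t| < a) (hst : |s + t| < a) : W (s + t) = W s * W t := by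
  have ha : 0 < a := (abs_nonneg s).trans_lt hs
  refine (hW.isSymmetricRel ha).eqOn_of_hasStrongDerivAt hι
    (Y := fun r => W (r + t)) (Z := fun r => W r * W t)
    (s := Set.Ioo (-a) a ∩ Set.Ioo (-a - t) (a - t)) (isOpen_Ioo.inter isOpen_Ioo)
    (Set.ordConnected_Ioo.inter Set.ordConnected_Ioo).isPreconnected
    (fun r hr => .comp_add_const t (hW.hasStrongDerivAt _ ?_))
    (fun r hr => by simpa [mul_assoc] using (hW.hasStrongDerivAt r (abs_lt.2 hr.1)).mul_const (W t))
    (t₀ := 0) ⟨by simpa using ha, ?_⟩ (by simp [hW.map_zero]) ⟨abs_lt.1 hs, ?_⟩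
  · exact abs_lt.2 ⟨by linarith [hr.2.1], by linarith [hr.2.2]⟩
  · exact ⟨by linarith [(abs_lt.1 ht).1], by linarith [(abs_lt.1 ht).2]⟩
  · exact ⟨by linarith [(abs_lt.1 hst).1], by linarith [(abs_lt.1 hst).2]⟩

theorem IsLocalFlow.exists_isFlow (hW : IsLocalFlow ι T a W) (ha : 0 < a)
    (hι : Function.Injective ι) : ∃ u, IsFlow ι T u ∧ ∀ t, |t| < a → u t = W t := by
  obtain ⟨u, hadd, heq, hpow⟩ := exists_map_add_extension ha fun s t => hW.map_add hι (s := s)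
  have hzero : |(0 : ℝ)| < a := by simpa using ha
  refine ⟨u, ⟨(heq 0 hzero).trans hW.map_zero, hadd, fun t => ?_, fun f => ?_⟩, heq⟩
  · obtain ⟨s, m, hs, h⟩ := hpow t
    exact h ▸ pow_mem (hW.isometric s hs) m
  · have h := hW.hasStrongDerivAt 0 hzero f
    rw [hW.map_zero, mul_one] at h
    refine h.congr_of_eventuallyEq ?_
    filter_upwards [Metric.ball_mem_nhds (0 : ℝ) ha] with s hs
    rw [heq s (by simpa using hs)]

namespace IsFlow

theorem hasStrongDerivAt (hu : IsFlow ι T u) (t : ℝ) :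
    HasStrongDerivAt ι u (Complex.I • (T * u t)) t := by
  have h := ((add_neg_cancel t).symm ▸ hu.hasStrongDerivAt_zero :
    HasStrongDerivAt ι u (Complex.I • T) (t + -t)).comp_add_const (-t) |>.mul_const (u t)
  simpa only [← hu.map_add, neg_add_cancel_right, smul_mul_assoc] using h

theorem isUnit (hu : IsFlow ι T u) (t : ℝ) : IsUnit (u t) :=
  ⟨⟨u t, u (-t), by rw [← hu.map_add, add_neg_cancel, hu.map_zero],
    by rw [← hu.map_add, neg_add_cancel, hu.map_zero]⟩, rfl⟩

theorem isLocalFlow (hu : IsFlow ι T u) (a : ℝ) : IsLocalFlow ι T a u :=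
  ⟨hu.map_zero, fun t _ => hu.isometric t, fun t _ => hu.hasStrongDerivAt t⟩

theorem isSymmetricRel (hu : IsFlow ι T u) : IsSymmetricRel (domGraph ι T) :=
  (hu.isLocalFlow 1).isSymmetricRel one_pos

theorem commute_of_isometric (hu : IsFlow ι T u) (hι : Function.Injective ι) {V : Module.End ℂ D}
    (hV : V ∈ isometricEnd ι) (hVT : Commute V T) (t : ℝ) : Commute V (u t) := by
  refine hu.isSymmetricRel.eqOn_of_hasStrongDerivAt hι (Y := fun t => V * u t)
    (Z := fun t => u t * V) isOpen_univ isPreconnected_univ (fun t _ => ?_) (fun t _ => ?_)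
    (Set.mem_univ 0) (by simp [hu.map_zero]) (Set.mem_univ t)
  · simpa [mul_smul_comm, ← mul_assoc, hVT.eq] using
      (HasStrongDerivAt.const V).mul (fun _ => hV) (hu.hasStrongDerivAt t)
  · simpa [mul_assoc] using (hu.hasStrongDerivAt t).mul_const V

theorem commute_generator (hu : IsFlow ι T u) (hι : Function.Injective ι) (t : ℝ) :
    Commute (u t) T := by
  have h : HasStrongDerivAt ι (fun s => u t * u s) (Complex.I • (T * u t)) 0 := by
    simpa only [← hu.map_add, add_comm t] using
      HasStrongDerivAt.comp_add_const t ((zero_add t).symm ▸ hu.hasStrongDerivAt t)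
  have h' := (HasStrongDerivAt.const (u t)).mul (fun _ => hu.isometric t) hu.hasStrongDerivAt_zero
  rw [zero_mul, zero_add, mul_smul_comm] at h'
  exact smul_right_injective _ Complex.I_ne_zero (h'.unique hι h)

theorem conj (hu : IsFlow ι T u) {V : (Module.End ℂ D)ˣ}
    (hV : (V : Module.End ℂ D) ∈ isometricEnd ι) {T' : Module.End ℂ D}
    (h : SemiconjBy (V : Module.End ℂ D) T T') : IsFlow ι T' fun t => V * u t * ↑V⁻¹ where
  map_zero := by simp [hu.map_zero]
  map_add s t := by simp [hu.map_add, mul_assoc]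
  isometric t := mul_mem (mul_mem hV (hu.isometric t)) (inv_mem_isometricEnd hV)
  hasStrongDerivAt_zero := by
    have hderiv := ((HasStrongDerivAt.const (V : Module.End ℂ D)).mul (fun _ => hV)
      hu.hasStrongDerivAt_zero).mul_const ↑V⁻¹
    rwa [zero_mul, zero_add, mul_smul_comm, h.eq, smul_mul_assoc, Units.mul_inv_cancel_right]
      at hderiv

theorem smul (hu : IsFlow ι T u) (c : ℝ) : IsFlow ι ((c : ℂ) • T) fun t => u (c * t) where
  map_zero := by simp [hu.map_zero]
  map_add s t := by rw [mul_add, hu.map_add]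
  isometric t := hu.isometric _
  hasStrongDerivAt_zero := by
    rw [smul_comm]
    exact .scomp (by simpa using hu.hasStrongDerivAt_zero)
      (by simpa using (hasDerivAt_id (0 : ℝ)).const_mul c)

/-- If `h` is orthogonal to the range of `T + i`, then `⟪h, u t f⟫` solves `y' = y`; being bounded,
it vanishes. -/
theorem dense_add_I_smul [CompleteSpace H] (hu : IsFlow ι T u) (hι : DenseRange ι) :
    Dense ((fun p : H × H => p.2 + Complex.I • p.1) '' domGraph ι T) := by
  have hrange : (fun p : H × H => p.2 + Complex.I • p.1) '' domGraph ι T =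
      LinearMap.range (ι ∘ₗ T + Complex.I • ι) := by
    ext
    simp [domGraph]
  rw [hrange, Submodule.dense_iff_topologicalClosure_eq_top,
    Submodule.topologicalClosure_eq_top_iff, Submodule.eq_bot_iff]
  intro h hh
  have hperp (f : D) : inner ℂ h (Complex.I • ι (T f)) = inner ℂ h (ι f) := by
    have horth := (Submodule.mem_orthogonal' _ _).1 hh _ ⟨f, rfl⟩
    simp only [LinearMap.add_apply, LinearMap.comp_apply, LinearMap.smul_apply, inner_add_right,
      inner_smul_right] at horth ⊢
    linear_combination Complex.I * horth - inner ℂ h (ι f) * Complex.I_mul_I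
  have hconst (f : D) (t : ℝ) : Real.exp (-t) • inner ℂ h (ι (u t f)) = inner ℂ h (ι f) := by
    have hderiv (t : ℝ) : HasDerivAt (fun t => Real.exp (-t) • inner ℂ h (ι (u t f))) 0 t := by
      simpa [hperp] using (hasDerivAt_neg t).exp.fun_smul
        ((hasDerivAt_const t h).inner ℂ (hu.hasStrongDerivAt t f))
    simpa [hu.map_zero] using is_const_of_deriv_eq_zero
      (fun t => (hderiv t).differentiableAt) (fun t => (hderiv t).deriv) t 0
  have hbound (f : D) (t : ℝ) : ‖inner ℂ h (ι f)‖ ≤ Real.exp (-t) * (‖h‖ * ‖ι f‖) := by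
    rw [← hconst f t, norm_smul, Real.norm_of_nonneg (Real.exp_pos _).le, ← hu.isometric t f]
    gcongr
    exact norm_inner_le_norm _ _
  have hzero (f : D) : inner ℂ h (ι f) = 0 :=
    norm_le_zero_iff.1 (ge_of_tendsto' (by
      simpa using Real.tendsto_exp_neg_atTop_nhds_zero.mul_const (‖h‖ * ‖ι f‖)) (hbound f))
  exact hι.eq_zero_of_inner_left ℂ hzero

theorem exists_isUnitaryGroup [CompleteSpace H] (hu : IsFlow ι T u) (hι : DenseRange ι) :
    ∃ U : ℝ → H →L[ℂ] H, IsUnitaryGroup U ∧ ∀ t f, U t (ι f) = ι (u t f) := by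
  let U (t : ℝ) : H →L[ℂ] H := (ι ∘ₗ u t).extendOfNorm ι
  have hUι (t : ℝ) (f : D) : U t (ι f) = ι (u t f) :=
    LinearMap.extendOfNorm_eq hι ⟨1, fun f => by simp [hu.isometric t f]⟩ f
  have hnorm (t : ℝ) (f : H) : ‖U t f‖ = ‖f‖ :=
    congrFun (hι.equalizer (U t).continuous.norm continuous_norm
      (funext fun f => by simp [hUι, hu.isometric t f])) f
  refine ⟨U, ⟨ext_of_denseRange hι fun f => by simp [hUι, hu.map_zero],
    fun s t => ext_of_denseRange hι fun f => by simp [hUι, hu.map_add], hnorm, fun f => ?_⟩, hUι⟩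
  refine continuous_of_uniform_approx_of_continuous fun s hs => ?_
  obtain ⟨ε, hε, hs⟩ := Metric.mem_uniformity_dist.1 hs
  obtain ⟨d, hd⟩ := hι.exists_dist_lt f hε
  refine ⟨fun t => ι (u t d),
    continuous_iff_continuousAt.2 fun t => (hu.hasStrongDerivAt t d).continuousAt,
    fun t => hs ?_⟩
  simpa only [← hUι, dist_eq_norm, ← map_sub, hnorm] using hd

theorem generator_eq [CompleteSpace H] (hu : IsFlow ι T u) (hι : DenseRange ι)
    {U : ℝ → H →L[ℂ] H} (hU : IsUnitaryGroup U) (hUι : ∀ t f, U t (ι f) = ι (u t f)) :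
    generator U = (domGraph ι T).topologicalClosure := by
  have hle : domGraph ι T ≤ generator U := by
    rintro _ ⟨f, rfl⟩
    simpa [mem_generator, hUι] using hu.hasStrongDerivAt_zero f
  exact (hU.isSymmetricRel_generator.le_topologicalClosure hle (hu.dense_add_I_smul hι)).antisymm
    (Submodule.topologicalClosure_minimal _ hle hU.isClosed_generator)

end IsFlow

end Flow

section ThreeFactor

theorem three_factor_coefficients {x : ℝ} (hx : Real.cos x ≠ 0) :
    let α := Real.tan x
    let β := Real.sin (2 * x)
    let α' := 1 / Real.cos x ^ 2 / 4
    let β' := Real.cos (2 * x) / 2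
    β' + α' * β ^ 2 = 1 / 2 ∧ β' * α + α' * (β ^ 2 * α - β) = 0 ∧
      α' + β' * α ^ 2 + α' * (1 - 2 * α * β + β ^ 2 * α ^ 2) = 1 / 2 := by
  have hsin : Real.sin x ^ 2 = 1 - Real.cos x ^ 2 := Real.sin_sq x
  simp only [Real.tan_eq_sin_div_cos, Real.sin_two_mul, Real.cos_two_mul]
  refine ⟨?_, ?_, ?_⟩ <;> field_simp <;> grind

/-- The families `A` and `B` act by conjugation on the span of `E`, `K`, `F` as the two unipotent
one-parameter subgroups of `SL₂` act in its adjoint representation. -/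
structure IsUnipotentPair {R : Type*} [Ring R] [Algebra ℂ R] (E K F : R) (A B : ℝ → R) :
    Prop where
  upper_semiconjBy_E : ∀ α : ℝ, SemiconjBy (A α) E (E + (α : ℂ) • K + (α : ℂ) ^ 2 • F)
  upper_semiconjBy_K : ∀ α : ℝ, SemiconjBy (A α) K (K + (2 * α : ℂ) • F)
  lower_semiconjBy_F : ∀ β : ℝ, SemiconjBy (B β) F (F - (β : ℂ) • K + (β : ℂ) ^ 2 • E)

/-- The left-hand side is, up to the factor `i`, the derivative of `A α B β A α` when `A` and `B`
are the flows of `F` and `E`. -/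
theorem IsUnipotentPair.velocity {R : Type*} [Ring R] [Algebra ℂ R] {E K F : R} {A B : ℝ → R}
    (h : IsUnipotentPair E K F A B) {α β α' β' : ℝ} (hAF : Commute (A α) F)
    (hE : β' + α' * β ^ 2 = 1 / 2) (hK : β' * α + α' * (β ^ 2 * α - β) = 0)
    (hF : α' + β' * α ^ 2 + α' * (1 - 2 * α * β + β ^ 2 * α ^ 2) = 1 / 2) :
    (α' : ℂ) • (F * (A α * B β * A α)) + (β' : ℂ) • (A α * (E * B β) * A α) +
        (α' : ℂ) • (A α * B β * (F * A α)) =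
      (1 / 2 : ℂ) • (E + F) * (A α * B β * A α) := by
  have hAE := h.upper_semiconjBy_E α
  have hABF := SemiconjBy.mul_left (SemiconjBy.add_right
    (SemiconjBy.sub_right hAF ((h.upper_semiconjBy_K α).smul_right (β : ℂ)))
    (hAE.smul_right ((β : ℂ) ^ 2))) (h.lower_semiconjBy_F β)
  have hsum : (α' : ℂ) • F + (β' : ℂ) • (E + (α : ℂ) • K + (α : ℂ) ^ 2 • F) +
      (α' : ℂ) • (F - (β : ℂ) • (K + (2 * α : ℂ) • F) +
        (β : ℂ) ^ 2 • (E + (α : ℂ) • K + (α : ℂ) ^ 2 • F)) = (1 / 2 : ℂ) • (E + F) := by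
    replace hE := congrArg Complex.ofReal hE
    replace hK := congrArg Complex.ofReal hK
    replace hF := congrArg Complex.ofReal hF
    push_cast at hE hK hF
    match_scalars
    · linear_combination hF
    · linear_combination hE
    · linear_combination hK
  rw [← hsum, ← mul_assoc (A α) E, hAE.eq, ← mul_assoc (A α * B β) F, hABF.eq]
  simp only [add_mul, smul_mul_assoc, mul_assoc]

variable {D H : Type*} [AddCommGroup D] [Module ℂ D] [NormedAddCommGroup H] [InnerProductSpace ℂ H]
  [NormedSpace ℝ H] {ι : D →ₗ[ℂ] H} {E K F : Module.End ℂ D} {A B : ℝ → Module.End ℂ D}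

theorem IsUnipotentPair.isLocalFlow (h : IsUnipotentPair E K F A B) (hA : IsFlow ι F A)
    (hB : IsFlow ι E B) (hι : Function.Injective ι) :
    IsLocalFlow ι ((1 / 2 : ℂ) • (E + F)) (2 * Real.pi) fun t =>
      A (Real.tan (t / 4)) * B (Real.sin (t / 2)) * A (Real.tan (t / 4)) where
  map_zero := by simp [hA.map_zero, hB.map_zero]
  isometric t _ := mul_mem (mul_mem (hA.isometric _) (hB.isometric _)) (hA.isometric _)
  hasStrongDerivAt t ht := by
    have hcos : Real.cos (t / 4) ≠ 0 := (Real.cos_pos_of_mem_Ioo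
      ⟨by linarith [(abs_lt.1 ht).1], by linarith [(abs_lt.1 ht).2]⟩).ne'
    have htan : HasDerivAt (fun t => Real.tan (t / 4)) (1 / Real.cos (t / 4) ^ 2 / 4) t := by
      simpa [Function.comp_def, div_eq_mul_inv] using
        (Real.hasDerivAt_tan hcos).comp t ((hasDerivAt_id t).div_const 4)
    have hsin : HasDerivAt (fun t => Real.sin (t / 2)) (Real.cos (t / 2) / 2) t := by
      simpa [Function.comp_def, div_eq_mul_inv] using
        (Real.hasDerivAt_sin (t / 2)).comp t ((hasDerivAt_id t).div_const 2)
    have hα := (hA.hasStrongDerivAt _).scomp htan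
    have hβ := (hB.hasStrongDerivAt _).scomp hsin
    have hderiv := (hα.mul (fun _ => hA.isometric _) hβ).mul
      (fun _ => mul_mem (hA.isometric _) (hB.isometric _)) hα
    have hcoeff := three_factor_coefficients hcos
    rw [show 2 * (t / 4) = t / 2 by ring] at hcoeff
    rw [← h.velocity (hA.commute_generator hι _) hcoeff.1 hcoeff.2.1 hcoeff.2.2]
    convert hderiv using 1
    simp only [smul_add, add_mul, mul_smul_comm, smul_mul_assoc, smul_comm Complex.I, mul_assoc]

end ThreeFactor

noncomputable section

section Multiplication

variable {E : Type*} [NormedAddCommGroup E] [InnerProductSpace ℝ E]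

/-- Multiplication by the linear form `⟪u, ·⟫`, the position operator in the direction `u`. -/
def position (u : E) : Module.End ℂ 𝓢(E, ℂ) :=
  (SchwartzMap.smulLeftCLM ℂ fun x : E => ((inner ℝ u x : ℝ) : ℂ)).toLinearMap

/-- The momentum operator `-i ∂_u` in the direction `u`. -/
def momentum (u : E) : Module.End ℂ 𝓢(E, ℂ) :=
  (-Complex.I) • (LineDeriv.lineDerivOpCLM ℂ 𝓢(E, ℂ) u).toLinearMap

/-- The unimodular function `x ↦ e^{i t ⟪u, x⟫ ⟪v, x⟫}`. -/
def quadraticPhase (u v : E) (t : ℝ) (x : E) : ℂ :=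
  Complex.exp ((t * (inner ℝ u x * inner ℝ v x) : ℝ) * Complex.I)

/-- Multiplication by `quadraticPhase u v t`, the operator `e^{i t x_u x_v}` on Schwartz
functions. -/
def chirp (u v : E) (t : ℝ) : Module.End ℂ 𝓢(E, ℂ) :=
  (SchwartzMap.smulLeftCLM ℂ (quadraticPhase u v t)).toLinearMap

theorem hasTemperateGrowth_cexp_ofReal_mul_I :
    Function.HasTemperateGrowth fun s : ℝ => Complex.exp (s * Complex.I) := by
  have hderiv (k : ℕ) : iteratedDeriv k (fun s : ℝ => Complex.exp (s * Complex.I)) =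
      fun s : ℝ => Complex.I ^ k * Complex.exp (s * Complex.I) := by
    induction k with
    | zero => simp
    | succ k ih =>
      funext s
      have h := ((Complex.ofRealCLM.hasDerivAt (x := s)).mul_const Complex.I).cexp.const_mul
        (Complex.I ^ k)
      rw [iteratedDeriv_succ, ih]
      refine h.deriv.trans ?_
      simp only [Complex.ofRealCLM_apply, Complex.ofReal_one, one_mul]
      ring
  refine ⟨(Complex.ofRealCLM.contDiff.mul contDiff_const).cexp, fun k => ⟨0, 1, fun s => ?_⟩⟩
  rw [norm_iteratedFDeriv_eq_norm_iteratedDeriv, hderiv]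
  simp [Complex.norm_exp_ofReal_mul_I]

theorem hasTemperateGrowth_ofReal_inner (u : E) :
    Function.HasTemperateGrowth fun x : E => ((inner ℝ u x : ℝ) : ℂ) := by
  fun_prop

theorem hasTemperateGrowth_quadraticPhase (u v : E) (t : ℝ) :
    Function.HasTemperateGrowth (quadraticPhase u v t) :=
  hasTemperateGrowth_cexp_ofReal_mul_I.comp
    (f := fun x : E => t * (inner ℝ u x * inner ℝ v x)) (by fun_prop)

theorem norm_quadraticPhase (u v : E) (t : ℝ) (x : E) : ‖quadraticPhase u v t x‖ = 1 :=
  Complex.norm_exp_ofReal_mul_I _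

theorem position_apply (u : E) (f : 𝓢(E, ℂ)) (x : E) :
    position u f x = (inner ℝ u x : ℝ) * f x :=
  SchwartzMap.smulLeftCLM_apply_apply (hasTemperateGrowth_ofReal_inner u) f x

theorem smulLeftCLM_inner_eq_position (w : E) (f : 𝓢(E, ℂ)) :
    SchwartzMap.smulLeftCLM ℂ (fun x : E => (inner ℝ x w : ℝ)) f = position w f := by
  ext x
  rw [position_apply,
    SchwartzMap.smulLeftCLM_apply_apply (Function.hasTemperateGrowth_inner_left w),
    real_inner_comm, Complex.real_smul]

theorem chirp_apply (u v : E) (t : ℝ) (f : 𝓢(E, ℂ)) (x : E) :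
    chirp u v t f x = quadraticPhase u v t x * f x :=
  SchwartzMap.smulLeftCLM_apply_apply (hasTemperateGrowth_quadraticPhase u v t) f x

theorem position_smul (c : ℝ) (u : E) : position (c • u) = (c : ℂ) • position u := by
  ext f x
  simp [position_apply, inner_smul_left, mul_assoc]

theorem momentum_add (u v : E) : momentum (u + v) = momentum u + momentum v := by
  ext f x
  simp [momentum, LineDeriv.lineDerivOp_left_add, add_comm]

theorem momentum_smul (c : ℝ) (u : E) : momentum (c • u) = (c : ℂ) • momentum u := by
  ext f x
  simp [momentum, LineDeriv.lineDerivOp_left_smul, mul_left_comm]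

theorem position_commute (u v : E) : Commute (position u) (position v) := by
  ext f x
  simp [position_apply, mul_left_comm]

theorem chirp_commute_position (u v w : E) (t : ℝ) : Commute (chirp u v t) (position w) := by
  ext f x
  simp [position_apply, chirp_apply, mul_left_comm]

theorem momentum_smulLeftCLM_apply {g : E → ℂ} (hg : g.HasTemperateGrowth) {g' : ℂ} {x w : E}
    (hg' : HasLineDerivAt ℝ g g' x w) (f : 𝓢(E, ℂ)) :
    momentum w (SchwartzMap.smulLeftCLM ℂ g f) x =
      g x * momentum w f x - Complex.I * g' * f x := by
  have hf : HasLineDerivAt ℝ f (lineDeriv ℝ f x w) x w :=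
    f.differentiableAt.lineDifferentiableAt.hasLineDerivAt
  have hgf : HasLineDerivAt ℝ (SchwartzMap.smulLeftCLM ℂ g f)
      (g' * f x + g x * lineDeriv ℝ f x w) x w := by
    rw [HasLineDerivAt, funext (SchwartzMap.smulLeftCLM_apply_apply hg f)]
    simpa using HasDerivAt.fun_mul hg' hf
  simp only [momentum, LinearMap.smul_apply, ContinuousLinearMap.coe_coe, smul_apply, smul_eq_mul,
    LineDeriv.lineDerivOpCLM_apply, SchwartzMap.lineDerivOp_apply, hgf.lineDeriv]
  ring

theorem hasLineDerivAt_inner (u x w : E) :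
    HasLineDerivAt ℝ (fun x => inner ℝ u x) (inner ℝ u w) x w :=
  ((innerSL ℝ u).hasFDerivAt (x := x)).hasLineDerivAt w

theorem momentum_mul_position (w u : E) :
    momentum w * position u = position u * momentum w - (inner ℝ u w * Complex.I) • 1 := by
  ext f x
  refine (momentum_smulLeftCLM_apply (hasTemperateGrowth_ofReal_inner u)
    (HasDerivAt.ofReal_comp (hasLineDerivAt_inner u x w)) f).trans ?_
  simp [position_apply, mul_comm Complex.I]

theorem chirp_semiconjBy_momentum (u v w : E) (t : ℝ) :
    SemiconjBy (chirp u v t) (momentum w) (momentum w -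
      (t : ℂ) • ((inner ℝ u w : ℂ) • position v + (inner ℝ v w : ℂ) • position u)) := by
  ext f x
  have hexponent : HasLineDerivAt ℝ (fun x => t * (inner ℝ u x * inner ℝ v x))
      (t * (inner ℝ u w * inner ℝ v x + inner ℝ u x * inner ℝ v w)) x w := by
    simpa [HasLineDerivAt] using HasDerivAt.const_mul t
      (HasDerivAt.fun_mul (hasLineDerivAt_inner u x w) (hasLineDerivAt_inner v x w))
  have hphase := ((HasDerivAt.ofReal_comp hexponent).mul_const Complex.I).cexp
  simp only [zero_smul, add_zero] at hphase
  rw [Module.End.mul_apply, chirp_apply, Module.End.mul_apply, LinearMap.sub_apply, sub_apply,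
    show momentum w (chirp u v t f) x = _ from
      momentum_smulLeftCLM_apply (hasTemperateGrowth_quadraticPhase u v t) hphase f]
  simp only [LinearMap.smul_apply, LinearMap.add_apply, smul_apply, add_apply, smul_eq_mul,
    position_apply, chirp_apply, Complex.ofReal_mul, Complex.ofReal_add, quadraticPhase]
  linear_combination (Complex.exp ((t * (inner ℝ u x * inner ℝ v x)) * Complex.I) * f x * t *
    (inner ℝ u w * inner ℝ v x + inner ℝ u x * inner ℝ v w)) * Complex.I_sq

theorem chirp_zero (u v : E) : chirp u v 0 = 1 := by
  ext f x
  simp [chirp_apply, quadraticPhase]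

theorem chirp_add (u v : E) (s t : ℝ) : chirp u v (s + t) = chirp u v s * chirp u v t := by
  ext f x
  simp only [chirp_apply, quadraticPhase, Module.End.mul_apply, ← mul_assoc, ← Complex.exp_add]
  congr 2
  push_cast
  ring

theorem position_sub_mul_position_half_add (e e' : E) :
    position (e - e') * position ((1 / 2 : ℝ) • (e + e')) =
      (1 / 2 : ℂ) • (position e * position e - position e' * position e') := by
  ext f x
  simp only [position_apply, inner_sub_left, inner_add_left, real_inner_smul_left,
    Module.End.mul_apply, LinearMap.smul_apply, LinearMap.sub_apply, smul_apply, sub_apply,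
    smul_eq_mul]
  push_cast
  ring

theorem chirp_sub_half_add (e e' : E) (t : ℝ) :
    chirp (e - e') ((1 / 2 : ℝ) • (e + e')) t = chirp e e (t / 2) * chirp e' e' (-(t / 2)) := by
  ext f x
  simp only [chirp_apply, quadraticPhase, Module.End.mul_apply, ← mul_assoc, ← Complex.exp_add,
    inner_sub_left, inner_add_left, real_inner_smul_left]
  congr 2
  push_cast
  ring

end Multiplication

section SquareIntegrable

variable {E : Type*} [NormedAddCommGroup E] [InnerProductSpace ℝ E] [FiniteDimensional ℝ E]
  [MeasurableSpace E] [BorelSpace E]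

/-- The inclusion of the Schwartz functions in `L²(E)`. -/
def toL2 : 𝓢(E, ℂ) →ₗ[ℂ] Lp ℂ 2 (volume : Measure E) :=
  (SchwartzMap.toLpCLM ℂ ℂ 2 (volume : Measure E)).toLinearMap

theorem toL2_injective : Function.Injective (toL2 (E := E)) :=
  SchwartzMap.injective_toLp 2 (volume : Measure E)

theorem denseRange_toL2 : DenseRange (toL2 (E := E)) :=
  SchwartzMap.denseRange_toLpCLM ENNReal.ofNat_ne_top

theorem norm_toL2_le {f g : 𝓢(E, ℂ)} {C : ℝ} (h : ∀ x, ‖f x‖ ≤ C * ‖g x‖) :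
    ‖toL2 f‖ ≤ C * ‖toL2 g‖ := by
  refine Lp.norm_le_mul_norm_of_ae_le_mul ?_
  filter_upwards [f.coeFn_toLp 2 volume, g.coeFn_toLp 2 volume] with x hf hg
  change ‖(f.toLp 2 volume) x‖ ≤ C * ‖(g.toLp 2 volume) x‖
  rw [hf, hg]
  exact h x

theorem norm_toL2_congr {f g : 𝓢(E, ℂ)} (h : ∀ x, ‖f x‖ = ‖g x‖) : ‖toL2 f‖ = ‖toL2 g‖ :=
  le_antisymm (by simpa using norm_toL2_le (C := 1) fun x => by rw [one_mul, h])
    (by simpa using norm_toL2_le (C := 1) fun x => by rw [one_mul, h])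

theorem norm_cexp_ofReal_mul_I_sub_one_sub_le (s : ℝ) :
    ‖Complex.exp (s * Complex.I) - 1 - s * Complex.I‖ ≤ 2 * s ^ 2 := by
  rcases le_total |s| 1 with hs | hs
  · have h := Complex.norm_exp_sub_one_sub_id_le (x := s * Complex.I) (by simpa using hs)
    simp only [norm_mul, Complex.norm_real, Complex.norm_I, mul_one, Real.norm_eq_abs,
      sq_abs] at h
    linarith [sq_nonneg s]
  · calc ‖Complex.exp (s * Complex.I) - 1 - s * Complex.I‖
        ≤ ‖Complex.exp (s * Complex.I) - 1‖ + ‖s * Complex.I‖ := norm_sub_le _ _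
      _ ≤ |s| + |s| := by
        gcongr
        · simpa [mul_comm] using Real.norm_exp_I_mul_ofReal_sub_one_le (x := s)
        · simp
      _ ≤ 2 * s ^ 2 := by nlinarith [sq_abs s]

theorem norm_chirp_sub_le (u v : E) (t : ℝ) (f : 𝓢(E, ℂ)) :
    ‖toL2 (chirp u v t f - f - ((t : ℂ) * Complex.I) • (position u * position v) f)‖ ≤
      2 * t ^ 2 * ‖toL2 ((position u * position v * (position u * position v)) f)‖ := by
  refine norm_toL2_le fun x => ?_
  set s : ℝ := inner ℝ u x * inner ℝ v x with hs
  have hmul (g : 𝓢(E, ℂ)) : (position u * position v) g x = s * g x := by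
    simp [position_apply, hs, mul_assoc]
  calc ‖(chirp u v t f - f - ((t : ℂ) * Complex.I) • (position u * position v) f) x‖
      = ‖Complex.exp ((t * s : ℝ) * Complex.I) - 1 - (t * s : ℝ) * Complex.I‖ * ‖f x‖ := by
        rw [← norm_mul]
        congr 1
        simp only [sub_apply, smul_apply, smul_eq_mul, hmul, chirp_apply, quadraticPhase, ← hs]
        push_cast
        ring
    _ ≤ 2 * (t * s) ^ 2 * ‖f x‖ := by
        gcongr
        exact norm_cexp_ofReal_mul_I_sub_one_sub_le _
    _ = 2 * t ^ 2 * ‖(position u * position v * (position u * position v)) f x‖ := by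
        rw [Module.End.mul_apply, hmul, hmul, norm_mul, norm_mul, Complex.norm_real,
          Real.norm_eq_abs, mul_pow, ← sq_abs s]
        ring

theorem isFlow_chirp (u v : E) : IsFlow toL2 (position u * position v) (chirp u v) where
  map_zero := chirp_zero u v
  map_add := chirp_add u v
  isometric t f := norm_toL2_congr fun x => by
    rw [chirp_apply, norm_mul, norm_quadraticPhase, one_mul]
  hasStrongDerivAt_zero f := by
    refine hasDerivAt_iff_isLittleO.2 (Asymptotics.IsBigO.trans_isLittleO (g := fun t => t ^ 2)
      (Asymptotics.IsBigO.of_bound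
        (2 * ‖toL2 ((position u * position v * (position u * position v)) f)‖)
        (Filter.Eventually.of_forall fun t => ?_))
      (by simpa using Asymptotics.isLittleO_pow_pow (𝕜 := ℝ) one_lt_two))
    rw [norm_pow, Real.norm_eq_abs, sq_abs, mul_right_comm]
    refine (congrArg norm ?_).trans_le (norm_chirp_sub_le u v t f)
    rw [chirp_zero, sub_zero, map_sub, map_sub, LinearMap.map_smul, mul_smul, Complex.coe_smul,
      LinearMap.smul_apply, LinearMap.map_smul, Module.End.one_apply]
    rfl

open FourierTransform

variable (E) in
/-- The inverse Fourier transform, as an invertible endomorphism of the Schwartz functions. -/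
def fourierInvUnit : (Module.End ℂ 𝓢(E, ℂ))ˣ :=
  LinearMap.GeneralLinearGroup.ofLinearEquiv (fourierEquiv ℂ 𝓢(E, ℂ)).symm

theorem fourierInvUnit_apply (f : 𝓢(E, ℂ)) :
    (fourierInvUnit E : Module.End ℂ 𝓢(E, ℂ)) f = 𝓕⁻ f :=
  rfl

theorem fourierInvUnit_mem_isometricEnd :
    (fourierInvUnit E : Module.End ℂ 𝓢(E, ℂ)) ∈ isometricEnd toL2 := fun f => by
  have h : ‖toL2 (𝓕 (𝓕⁻ f))‖ = ‖toL2 (𝓕⁻ f)‖ := SchwartzMap.norm_fourier_toL2_eq (𝓕⁻ f)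
  rw [fourierInvUnit_apply, ← h, fourier_fourierInv_eq]

theorem fourierInvUnit_semiconjBy_position (w : E) :
    SemiconjBy (fourierInvUnit E : Module.End ℂ 𝓢(E, ℂ)) (position ((2 * Real.pi) • w))
      (momentum w) := by
  ext1 f
  have h := SchwartzMap.lineDerivOp_fourierInv_eq f w
  rw [smulLeftCLM_inner_eq_position] at h
  change 𝓕⁻ (position ((2 * Real.pi) • w) f) = -Complex.I • ∂_{w} (𝓕⁻ f)
  rw [h, position_smul, ← FourierTransform.fourierInv_smul, smul_smul, LinearMap.smul_apply]
  congr 2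
  push_cast
  linear_combination (2 * Real.pi : ℂ) * Complex.I_sq

theorem fourierInvUnit_semiconjBy_momentum (w : E) :
    SemiconjBy (fourierInvUnit E : Module.End ℂ 𝓢(E, ℂ)) (momentum w)
      (-position ((2 * Real.pi) • w)) := by
  ext1 f
  have h := SchwartzMap.fourierInv_lineDerivOp_eq f w
  rw [smulLeftCLM_inner_eq_position] at h
  change 𝓕⁻ (-Complex.I • ∂_{w} f) = -position ((2 * Real.pi) • w) (𝓕⁻ f)
  rw [FourierTransform.fourierInv_smul, h, position_smul, LinearMap.smul_apply, smul_smul,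
    ← neg_smul]
  congr 1
  push_cast
  linear_combination (2 * Real.pi : ℂ) * Complex.I_sq

theorem momentum_commute (u v : E) : Commute (momentum u) (momentum v) := by
  have h (u v : E) := ((fourierInvUnit_semiconjBy_position u).mul_right
    (fourierInvUnit_semiconjBy_position v)).eq
  refine (fourierInvUnit E).isUnit.mul_right_cancel ?_
  rw [← h, ← h, (position_commute _ _).eq]

/-- The Fourier multiplier with symbol `quadraticPhase (2π u) (2π v) t`, the operator
`e^{i t p_u p_v}` on Schwartz functions. -/
def chirpMultiplier (u v : E) (t : ℝ) : Module.End ℂ 𝓢(E, ℂ) :=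
  fourierInvUnit E * chirp ((2 * Real.pi) • u) ((2 * Real.pi) • v) t *
    (((fourierInvUnit E)⁻¹ : (Module.End ℂ 𝓢(E, ℂ))ˣ) : Module.End ℂ 𝓢(E, ℂ))

theorem isFlow_chirpMultiplier (u v : E) :
    IsFlow toL2 (momentum u * momentum v) (chirpMultiplier u v) :=
  (isFlow_chirp _ _).conj fourierInvUnit_mem_isometricEnd
    ((fourierInvUnit_semiconjBy_position u).mul_right (fourierInvUnit_semiconjBy_position v))

theorem chirpMultiplier_commute_momentum (u v w : E) (t : ℝ) :
    Commute (chirpMultiplier u v t) (momentum w) :=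
  ((fourierInvUnit_semiconjBy_position w).mul_left (chirp_commute_position _ _ _ t)).mul_left
    (fourierInvUnit_semiconjBy_position w).units_inv_symm_left

theorem chirpMultiplier_semiconjBy_position (u v w : E) (t : ℝ) :
    SemiconjBy (chirpMultiplier u v t) (position w) (position w +
      (t : ℂ) • ((inner ℝ u w : ℂ) • momentum v + (inner ℝ v w : ℂ) • momentum u)) := by
  obtain ⟨w, rfl⟩ : ∃ w' : E, (2 * Real.pi) • w' = w :=
    ⟨(2 * Real.pi)⁻¹ • w, smul_inv_smul₀ Real.two_pi_pos.ne' w⟩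
  have hinv := (fourierInvUnit_semiconjBy_momentum w).units_inv_symm_left
  have hchirp := chirp_semiconjBy_momentum ((2 * Real.pi) • u) ((2 * Real.pi) • v) w t
  have hfourier := (fourierInvUnit_semiconjBy_momentum w).sub_right
    ((((fourierInvUnit_semiconjBy_position v).smul_right
      (inner ℝ ((2 * Real.pi) • u) w : ℂ)).add_right
      ((fourierInvUnit_semiconjBy_position u).smul_right
        (inner ℝ ((2 * Real.pi) • v) w : ℂ))).smul_right (t : ℂ))
  simpa [real_inner_smul_left, real_inner_smul_right, chirpMultiplier, add_comm] using
    ((hfourier.mul_left hchirp).mul_left hinv).neg_right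

end SquareIntegrable

end

section Quadratic

variable {E : Type*} [NormedAddCommGroup E] [InnerProductSpace ℝ E] [FiniteDimensional ℝ E]
  [MeasurableSpace E] [BorelSpace E] {e e' : E}

theorem isUnipotentPair_chirp {u v : E} (huv : inner ℝ u v = 0)
    (hnorm : inner ℝ u u * inner ℝ v v = 1) :
    IsUnipotentPair (position u * position v)
      ((inner ℝ v v : ℂ) • (position u * momentum u) +
        (inner ℝ u u : ℂ) • (momentum v * position v))
      (momentum u * momentum v) (chirpMultiplier u v) (chirp u v) := by
  have hvu : inner ℝ v u = 0 := by rw [real_inner_comm, huv]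
  have hnorm' : ((inner ℝ u u : ℂ) * inner ℝ v v) = 1 := by exact_mod_cast hnorm
  have hxu (α : ℝ) : SemiconjBy (chirpMultiplier u v α) (position u)
      (position u + (α * inner ℝ u u : ℂ) • momentum v) := by
    simpa [hvu, smul_smul] using chirpMultiplier_semiconjBy_position u v u α
  have hxv (α : ℝ) : SemiconjBy (chirpMultiplier u v α) (position v)
      (position v + (α * inner ℝ v v : ℂ) • momentum u) := by
    simpa [huv, smul_smul] using chirpMultiplier_semiconjBy_position u v v α
  have hpu (β : ℝ) : SemiconjBy (chirp u v β) (momentum u)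
      (momentum u - (β * inner ℝ u u : ℂ) • position v) := by
    simpa [hvu, smul_smul] using chirp_semiconjBy_momentum u v u β
  have hpv (β : ℝ) : SemiconjBy (chirp u v β) (momentum v)
      (momentum v - (β * inner ℝ v v : ℂ) • position u) := by
    simpa [huv, smul_smul] using chirp_semiconjBy_momentum u v v β
  refine ⟨fun α => ?_, fun α => ?_, fun β => ?_⟩
  · refine ((hxu α).mul_right (hxv α)).eq.trans (congrArg (· * _) ?_)
    simp only [add_mul, mul_add, smul_mul_assoc, mul_smul_comm, (momentum_commute v u).eq]
    match_scalars <;> grind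
  · refine ((((hxu α).mul_right (chirpMultiplier_commute_momentum u v u α)).smul_right
      (inner ℝ v v : ℂ)).add_right ((SemiconjBy.mul_right (chirpMultiplier_commute_momentum u v v α)
        (hxv α)).smul_right (inner ℝ u u : ℂ))).eq.trans (congrArg (· * _) ?_)
    simp only [add_mul, mul_add, smul_mul_assoc, mul_smul_comm, (momentum_commute v u).eq]
    match_scalars <;> grind
  · refine ((hpu β).mul_right (hpv β)).eq.trans (congrArg (· * _) ?_)
    simp only [sub_mul, mul_sub, smul_mul_assoc, mul_smul_comm, (position_commute v u).eq,
      momentum_mul_position]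
    match_scalars <;> grind

theorem exists_isFlow_beamSplitter {u v : E} (huv : inner ℝ u v = 0)
    (hnorm : inner ℝ u u * inner ℝ v v = 1) :
    ∃ W, IsFlow toL2 ((1 / 2 : ℂ) • (position u * position v + momentum u * momentum v)) W ∧
      ∀ t, |t| < 2 * Real.pi → W t = chirpMultiplier u v (Real.tan (t / 4)) *
        chirp u v (Real.sin (t / 2)) * chirpMultiplier u v (Real.tan (t / 4)) :=
  ((isUnipotentPair_chirp huv hnorm).isLocalFlow (isFlow_chirpMultiplier u v) (isFlow_chirp u v)
    toL2_injective).exists_isFlow Real.two_pi_pos toL2_injective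

/-- `V` acts by conjugation as a quarter turn `x_e ↦ p_e ↦ -x_e` of the phase plane of the
direction `e` and fixes the orthogonal positions and momenta. -/
structure IsQuarterTurn (e : E) (V : (Module.End ℂ 𝓢(E, ℂ))ˣ) : Prop where
  isometric : (V : Module.End ℂ 𝓢(E, ℂ)) ∈ isometricEnd toL2
  semiconjBy_position : SemiconjBy ↑V (position e) (momentum e)
  semiconjBy_momentum : SemiconjBy ↑V (momentum e) (-position e)
  commute_position : ∀ w, inner ℝ e w = 0 → Commute ↑V (position w)
  commute_momentum : ∀ w, inner ℝ e w = 0 → Commute ↑V (momentum w)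

theorem exists_isQuarterTurn (he : inner ℝ e e = 1) : ∃ V, IsQuarterTurn e V := by
  have hC := isFlow_chirp e e
  have hM := isFlow_chirpMultiplier e e
  obtain ⟨V, hV⟩ := ((hM.isUnit (1 / 2)).mul (hC.isUnit (1 / 2))).mul (hM.isUnit (1 / 2))
  have hx : SemiconjBy (chirpMultiplier e e (1 / 2)) (position e) (position e + momentum e) := by
    convert chirpMultiplier_semiconjBy_position e e e (1 / 2) using 1
    rw [he]
    push_cast
    module
  have hp : SemiconjBy (chirp e e (1 / 2)) (momentum e) (momentum e - position e) := by
    convert chirp_semiconjBy_momentum e e e (1 / 2) using 1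
    rw [he]
    push_cast
    module
  have hMp := chirpMultiplier_commute_momentum e e e (1 / 2)
  refine ⟨V, ?_, ?_, ?_, fun w hw => ?_, fun w hw => ?_⟩ <;> rw [hV]
  · exact mul_mem (mul_mem (hM.isometric _) (hC.isometric _)) (hM.isometric _)
  · have hCxp := SemiconjBy.add_right (chirp_commute_position e e e (1 / 2)) hp
    rw [add_sub_cancel] at hCxp
    exact (SemiconjBy.mul_left hMp hCxp).mul_left hx
  · have hMpx := SemiconjBy.sub_right hMp hx
    rw [sub_add_cancel_right] at hMpx
    exact (hMpx.mul_left hp).mul_left hMp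
  · have hMw : Commute (chirpMultiplier e e (1 / 2)) (position w) := by
      simpa [Commute, hw] using chirpMultiplier_semiconjBy_position e e w (1 / 2)
    exact (hMw.mul_left (chirp_commute_position e e w _)).mul_left hMw
  · have hCw : Commute (chirp e e (1 / 2)) (momentum w) := by
      simpa [Commute, hw] using chirp_semiconjBy_momentum e e w (1 / 2)
    exact ((chirpMultiplier_commute_momentum e e w _).mul_left hCw).mul_left
      (chirpMultiplier_commute_momentum e e w _)

theorem exists_isFlow_rotation (he : inner ℝ e e = 1) (he' : inner ℝ e' e' = 1)
    (hee' : inner ℝ e e' = 0) :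
    ∃ W P Q, IsFlow toL2 ((1 / 2 : ℂ) • (momentum e * position e' - position e * momentum e')) W ∧
      IsFlow toL2 (position e * momentum e') P ∧ IsFlow toL2 (momentum e * position e') Q ∧
      ∀ t, |t| < 2 * Real.pi →
        W t = P (-Real.tan (t / 4)) * Q (Real.sin (t / 2)) * P (-Real.tan (t / 4)) := by
  obtain ⟨V, hV⟩ := exists_isQuarterTurn he
  obtain ⟨W, hW, hfactor⟩ := exists_isFlow_beamSplitter hee' (by rw [he, he', one_mul])
  have hQ : SemiconjBy (V : Module.End ℂ 𝓢(E, ℂ)) (position e * position e')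
      (momentum e * position e') :=
    hV.semiconjBy_position.mul_right (hV.commute_position e' hee')
  have hP : SemiconjBy (V : Module.End ℂ 𝓢(E, ℂ)) (momentum e * momentum e')
      (-(position e * momentum e')) := by
    simpa using hV.semiconjBy_momentum.mul_right (hV.commute_momentum e' hee')
  have hW' : SemiconjBy (V : Module.End ℂ 𝓢(E, ℂ))
      ((1 / 2 : ℂ) • (position e * position e' + momentum e * momentum e'))
      ((1 / 2 : ℂ) • (momentum e * position e' - position e * momentum e')) := by
    rw [sub_eq_add_neg]
    exact (hQ.add_right hP).smul_right _
  refine ⟨_, _, _, hW.conj hV.isometric hW',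
    ((isFlow_chirpMultiplier e e').smul (-1)).conj hV.isometric (by simpa using hP.neg_right),
    (isFlow_chirp e e').conj hV.isometric hQ, fun t ht => ?_⟩
  simp [hfactor t ht, mul_assoc]

theorem momentum_sub_mul_momentum_half_add (e e' : E) :
    momentum (e - e') * momentum ((1 / 2 : ℝ) • (e + e')) =
      (1 / 2 : ℂ) • (momentum e * momentum e - momentum e' * momentum e') := by
  rw [sub_eq_add_neg, ← neg_one_smul ℝ e']
  simp only [momentum_add, momentum_smul, add_mul, mul_add, smul_mul_assoc, mul_smul_comm,
    (momentum_commute e' e).eq]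
  push_cast
  module

theorem chirpMultiplier_sub_half_add (e e' : E) (t : ℝ) :
    chirpMultiplier (e - e') ((1 / 2 : ℝ) • (e + e')) t =
      chirpMultiplier e e (t / 2) * chirpMultiplier e' e' (-(t / 2)) := by
  rw [chirpMultiplier, smul_sub, smul_comm, smul_add, chirp_sub_half_add]
  simp [chirpMultiplier, mul_assoc]

theorem chirp_commute_chirpMultiplier (hee' : inner ℝ e e' = 0) (s t : ℝ) :
    Commute (chirp e e s) (chirpMultiplier e' e' t) := by
  have hcomm : Commute (chirp e e s) (momentum e') := by
    simpa [Commute, hee'] using chirp_semiconjBy_momentum e e e' s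
  exact (isFlow_chirpMultiplier e' e').commute_of_isometric toL2_injective
    ((isFlow_chirp e e).isometric s) (hcomm.mul_right hcomm) t

theorem chirpMultiplier_commute (u v u' v' : E) (s t : ℝ) :
    Commute (chirpMultiplier u v s) (chirpMultiplier u' v' t) :=
  (isFlow_chirpMultiplier u' v').commute_of_isometric toL2_injective
    ((isFlow_chirpMultiplier u v).isometric s)
    (SemiconjBy.mul_right (chirpMultiplier_commute_momentum u v u' s)
      (chirpMultiplier_commute_momentum u v v' s)) t

theorem exists_isFlow_number_sub (he : inner ℝ e e = 1) (he' : inner ℝ e' e' = 1)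
    (hee' : inner ℝ e e' = 0) :
    ∃ W, IsFlow toL2 ((1 / 2 : ℂ) • (position e * position e + momentum e * momentum e -
        position e' * position e' - momentum e' * momentum e')) W ∧
      ∀ t, |t| < Real.pi → W t =
        chirpMultiplier e e (Real.tan (t / 2) / 2) * chirp e e (Real.sin t / 2) *
          chirpMultiplier e e (Real.tan (t / 2) / 2) *
          chirpMultiplier e' e' (-(Real.tan (t / 2) / 2)) * chirp e' e' (-(Real.sin t / 2)) *
          chirpMultiplier e' e' (-(Real.tan (t / 2) / 2)) := by
  have he'e : inner ℝ e' e = 0 := by rw [real_inner_comm, hee']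
  obtain ⟨W, hW, hfactor⟩ := exists_isFlow_beamSplitter (u := e - e')
    (v := (1 / 2 : ℝ) • (e + e'))
    (by
      simp only [inner_sub_left, inner_add_right, real_inner_smul_right, he, he', hee', he'e]
      norm_num)
    (by
      simp only [inner_sub_left, inner_sub_right, inner_add_left, inner_add_right,
        real_inner_smul_left, real_inner_smul_right, he, he', hee', he'e]
      norm_num)
  refine ⟨fun t => W (2 * t), ?_, fun t ht => ?_⟩
  · convert hW.smul 2 using 1
    rw [position_sub_mul_position_half_add, momentum_sub_mul_momentum_half_add]
    push_cast
    module
  · have h := hfactor (2 * t) (by rw [abs_mul, abs_two]; linarith)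
    rw [show 2 * t / 4 = t / 2 by ring, mul_div_cancel_left₀ t two_ne_zero,
      chirpMultiplier_sub_half_add, chirp_sub_half_add] at h
    set a := Real.tan (t / 2) / 2
    set b := Real.sin t / 2
    have hMC : Commute (chirpMultiplier e' e' (-a)) (chirp e e b) :=
      (chirp_commute_chirpMultiplier hee' b (-a)).symm
    have hCM : Commute (chirp e' e' (-b)) (chirpMultiplier e e a) :=
      chirp_commute_chirpMultiplier he'e (-b) a
    have hMM : Commute (chirpMultiplier e' e' (-a)) (chirpMultiplier e e a) :=
      chirpMultiplier_commute e' e' e e (-a) a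
    change W (2 * t) = _
    simp only [h, mul_assoc]
    rw [hMC.left_comm, hCM.left_comm, hMM.left_comm]

end Quadratic

section Exponential

variable {n : ℕ} {T : Schw n →L[ℂ] Schw n} {u : ℝ → Module.End ℂ (Schw n)}

theorem isExpGroup_iff {U : ℝ → Hilb n →L[ℂ] Hilb n} :
    IsExpGroup T U ↔
      IsUnitaryGroup U ∧ generator U = (domGraph toL2 T.toLinearMap).topologicalClosure :=
  ⟨fun h => ⟨⟨h.map_zero, h.map_add, h.norm_map, h.continuous⟩,
      Submodule.ext fun p => h.generator p.1 p.2⟩,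
    fun ⟨h, hgen⟩ => ⟨h.map_zero, h.map_add, h.norm_map, h.continuous,
      fun f g => (SetLike.ext_iff.1 hgen (f, g) :)⟩⟩

theorem IsExpGroup.eq {U V : ℝ → Hilb n →L[ℂ] Hilb n} (hU : IsExpGroup T U)
    (hV : IsExpGroup T V) : U = V := by
  obtain ⟨hU, hgenU⟩ := isExpGroup_iff.1 hU
  obtain ⟨hV, hgenV⟩ := isExpGroup_iff.1 hV
  refine hU.eq_of_generator_eq hV (hgenU.trans hgenV.symm) (denseRange_toL2.mono ?_)
  rintro _ ⟨f, rfl⟩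
  exact ⟨_, hgenU ▸ Submodule.le_topologicalClosure _ (mem_domGraph toL2 T.toLinearMap f), rfl⟩

theorem IsFlow.exists_isExpGroup (hu : IsFlow toL2 T.toLinearMap u) :
    ∃ U, IsExpGroup T U ∧ ∀ t f, U t (toL2 f) = toL2 (u t f) := by
  obtain ⟨U, hU, hUι⟩ := hu.exists_isUnitaryGroup denseRange_toL2
  exact ⟨U, isExpGroup_iff.2 ⟨hU, hu.generator_eq denseRange_toL2 hU hUι⟩, hUι⟩

theorem IsFlow.hasExp (hu : IsFlow toL2 T.toLinearMap u) : HasExp T := by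
  obtain ⟨U, hU, -⟩ := hu.exists_isExpGroup
  exact ⟨U, hU, fun V hV => hV.eq hU⟩

theorem IsFlow.expI_toL2 (hu : IsFlow toL2 T.toLinearMap u) (t : ℝ) (f : Schw n) :
    expI t T (toL2 f) = toL2 (u t f) := by
  obtain ⟨U, hU, hUι⟩ := hu.exists_isExpGroup
  rw [expI, dif_pos hu.hasExp, hu.hasExp.choose_spec.1.eq hU, hUι]

end Exponential

section Modes

variable {n : ℕ} {i i' j k : Fin n}

theorem inner_single_single_self (j : Fin n) :
    inner ℝ (EuclideanSpace.single j 1 : Config n) (EuclideanSpace.single j 1) = 1 := by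
  simp

theorem inner_single_single_of_ne (hjk : j ≠ k) :
    inner ℝ (EuclideanSpace.single j 1 : Config n) (EuclideanSpace.single k 1) = 0 :=
  EuclideanSpace.orthonormal_single.2 hjk

theorem toLinearMap_posOp (j : Fin n) :
    (posOp j).toLinearMap = position (EuclideanSpace.single j 1) := by
  ext f x
  simp [posOp_apply, position_apply, EuclideanSpace.inner_single_left]

theorem toLinearMap_momOp (j : Fin n) :
    (momOp j).toLinearMap = momentum (EuclideanSpace.single j 1) :=
  rfl

theorem isFlow_posOp_comp_posOp (j k : Fin n) : IsFlow toL2 (posOp j ∘L posOp k).toLinearMap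
    (chirp (EuclideanSpace.single j 1) (EuclideanSpace.single k 1)) := by
  have h := isFlow_chirp (EuclideanSpace.single j 1 : Config n) (EuclideanSpace.single k 1)
  rwa [← toLinearMap_posOp, ← toLinearMap_posOp] at h

theorem isFlow_momOp_comp_momOp (j k : Fin n) : IsFlow toL2 (momOp j ∘L momOp k).toLinearMap
    (chirpMultiplier (EuclideanSpace.single j 1) (EuclideanSpace.single k 1)) :=
  isFlow_chirpMultiplier _ _

theorem hasExp_opH_and_expI_opH (h : i ≠ i') : HasExp (opH i i') ∧ ∀ t, |t| < Real.pi →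
    expI t (opH i i') =
      expI (Real.tan (t / 2) / 2) (momOp i ∘L momOp i) ∘L
      expI (Real.sin t / 2) (posOp i ∘L posOp i) ∘L
      expI (Real.tan (t / 2) / 2) (momOp i ∘L momOp i) ∘L
      expI (-(Real.tan (t / 2) / 2)) (momOp i' ∘L momOp i') ∘L
      expI (-(Real.sin t / 2)) (posOp i' ∘L posOp i') ∘L
      expI (-(Real.tan (t / 2) / 2)) (momOp i' ∘L momOp i') := by
  obtain ⟨W, hW, hfactor⟩ := exists_isFlow_number_sub (inner_single_single_self i)
    (inner_single_single_self i') (inner_single_single_of_ne h)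
  simp only [← toLinearMap_posOp, ← toLinearMap_momOp] at hW
  change IsFlow toL2 (opH i i').toLinearMap W at hW
  refine ⟨hW.hasExp, fun t ht => ext_of_denseRange denseRange_toL2 fun f => ?_⟩
  simp only [ContinuousLinearMap.comp_apply, hW.expI_toL2,
    (isFlow_posOp_comp_posOp _ _).expI_toL2, (isFlow_momOp_comp_momOp _ _).expI_toL2,
    hfactor t ht, Module.End.mul_apply]

theorem hasExp_opS_and_expI_opS (h : j ≠ k) : HasExp (opS j k) ∧ ∀ t, |t| < 2 * Real.pi →
    expI t (opS j k) =
      expI (Real.tan (t / 4)) (momOp j ∘L momOp k) ∘L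
      expI (Real.sin (t / 2)) (posOp j ∘L posOp k) ∘L
      expI (Real.tan (t / 4)) (momOp j ∘L momOp k) := by
  obtain ⟨W, hW, hfactor⟩ := exists_isFlow_beamSplitter (inner_single_single_of_ne h)
    (by rw [inner_single_single_self, inner_single_single_self, one_mul])
  simp only [← toLinearMap_posOp, ← toLinearMap_momOp] at hW
  change IsFlow toL2 (opS j k).toLinearMap W at hW
  refine ⟨hW.hasExp, fun t ht => ext_of_denseRange denseRange_toL2 fun f => ?_⟩
  simp only [ContinuousLinearMap.comp_apply, hW.expI_toL2,
    (isFlow_posOp_comp_posOp _ _).expI_toL2, (isFlow_momOp_comp_momOp _ _).expI_toL2,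
    hfactor t ht, Module.End.mul_apply]

theorem hasExp_opA_and_expI_opA (h : j ≠ k) :
    HasExp (posOp j ∘L momOp k) ∧ HasExp (momOp j ∘L posOp k) ∧ HasExp (opA j k) ∧
      ∀ t, |t| < 2 * Real.pi →
        expI t (opA j k) =
          expI (-Real.tan (t / 4)) (posOp j ∘L momOp k) ∘L
          expI (Real.sin (t / 2)) (momOp j ∘L posOp k) ∘L
          expI (-Real.tan (t / 4)) (posOp j ∘L momOp k) := by
  obtain ⟨W, P, Q, hW, hP, hQ, hfactor⟩ := exists_isFlow_rotation (inner_single_single_self j)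
    (inner_single_single_self k) (inner_single_single_of_ne h)
  simp only [← toLinearMap_posOp, ← toLinearMap_momOp] at hW hP hQ
  change IsFlow toL2 (opA j k).toLinearMap W at hW
  change IsFlow toL2 (posOp j ∘L momOp k).toLinearMap P at hP
  change IsFlow toL2 (momOp j ∘L posOp k).toLinearMap Q at hQ
  refine ⟨hP.hasExp, hQ.hasExp, hW.hasExp, fun t ht => ext_of_denseRange denseRange_toL2
    fun f => ?_⟩
  simp only [ContinuousLinearMap.comp_apply, hW.expI_toL2, hP.expI_toL2, hQ.expI_toL2,
    hfactor t ht, Module.End.mul_apply]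

end Modes

end Oscillator

open Oscillator in
theorem lemma1_general (n : ℕ) (ς ϑ φ : ℝ) (hς : |ς| < Real.pi) (hϑ : |ϑ| < 2 * Real.pi)
    (hφ : |φ| < 2 * Real.pi) :
    (∀ j : Fin n, HasExp (posOp j ∘L posOp j) ∧ HasExp (momOp j ∘L momOp j)) ∧
    (∀ j k : Fin n, j ≠ k →
      HasExp (posOp j ∘L posOp k) ∧ HasExp (momOp j ∘L momOp k) ∧
      HasExp (posOp j ∘L momOp k) ∧ HasExp (momOp j ∘L posOp k) ∧
      HasExp (opS j k) ∧ HasExp (opA j k)) ∧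
    (∀ i i' : Fin n, i ≠ i' → HasExp (opH i i')) ∧
    (∀ i i' : Fin n, i ≠ i' →
      expI ς (opH i i') =
        expI (Real.tan (ς / 2) / 2) (momOp i ∘L momOp i) ∘L
        expI (Real.sin ς / 2) (posOp i ∘L posOp i) ∘L
        expI (Real.tan (ς / 2) / 2) (momOp i ∘L momOp i) ∘L
        expI (-(Real.tan (ς / 2) / 2)) (momOp i' ∘L momOp i') ∘L
        expI (-(Real.sin ς / 2)) (posOp i' ∘L posOp i') ∘L
        expI (-(Real.tan (ς / 2) / 2)) (momOp i' ∘L momOp i')) ∧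
    (∀ j k : Fin n, j ≠ k →
      expI ϑ (opS j k) =
        expI (Real.tan (ϑ / 4)) (momOp j ∘L momOp k) ∘L
        expI (Real.sin (ϑ / 2)) (posOp j ∘L posOp k) ∘L
        expI (Real.tan (ϑ / 4)) (momOp j ∘L momOp k)) ∧
    (∀ j k : Fin n, j ≠ k →
      expI φ (opA j k) =
        expI (-Real.tan (φ / 4)) (posOp j ∘L momOp k) ∘L
        expI (Real.sin (φ / 2)) (momOp j ∘L posOp k) ∘L
        expI (-Real.tan (φ / 4)) (posOp j ∘L momOp k)) := by
  refine ⟨fun j => ⟨(isFlow_posOp_comp_posOp j j).hasExp, (isFlow_momOp_comp_momOp j j).hasExp⟩,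
    fun j k hjk => ?_, fun i i' hii' => (hasExp_opH_and_expI_opH hii').1,
    fun i i' hii' => (hasExp_opH_and_expI_opH hii').2 ς hς,
    fun j k hjk => (hasExp_opS_and_expI_opS hjk).2 ϑ hϑ, fun j k hjk => ?_⟩
  · obtain ⟨hxp, hpx, hA, -⟩ := hasExp_opA_and_expI_opA hjk
    exact ⟨(isFlow_posOp_comp_posOp j k).hasExp, (isFlow_momOp_comp_momOp j k).hasExp, hxp, hpx,
      (hasExp_opS_and_expI_opS hjk).1, hA⟩
  · obtain ⟨-, -, -, hfactor⟩ := hasExp_opA_and_expI_opA hjk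
    exact hfactor φ hφ

open Oscillator in
theorem lemma1 (n : ℕ) (hn : 2 ≤ n) (ς ϑ φ : ℝ)
    (hς : ς ∈ Set.Icc (-(Real.pi / 2)) (Real.pi / 2))
    (hϑ : ϑ ∈ Set.Icc (-(Real.pi / 2)) (Real.pi / 2))
    (hφ : φ ∈ Set.Icc (-(Real.pi / 2)) (Real.pi / 2)) :
    -- all the exponentials below are well defined
    (∀ j : Fin n, HasExp (posOp j ∘L posOp j) ∧ HasExp (momOp j ∘L momOp j)) ∧
    (∀ j k : Fin n, j < k →
      HasExp (posOp j ∘L posOp k) ∧ HasExp (momOp j ∘L momOp k) ∧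
      HasExp (posOp j ∘L momOp k) ∧ HasExp (momOp j ∘L posOp k) ∧
      HasExp (opS j k) ∧ HasExp (opA j k)) ∧
    (∀ i i' : Fin n, (i' : ℕ) = i + 1 → HasExp (opH i i')) ∧
    -- the three factorizations
    (∀ i i' : Fin n, (i' : ℕ) = i + 1 →
      expI ς (opH i i') =
        expI (Real.tan (ς / 2) / 2) (momOp i ∘L momOp i) ∘L
        expI (Real.sin ς / 2) (posOp i ∘L posOp i) ∘L
        expI (Real.tan (ς / 2) / 2) (momOp i ∘L momOp i) ∘L
        expI (-(Real.tan (ς / 2) / 2)) (momOp i' ∘L momOp i') ∘L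
        expI (-(Real.sin ς / 2)) (posOp i' ∘L posOp i') ∘L
        expI (-(Real.tan (ς / 2) / 2)) (momOp i' ∘L momOp i')) ∧
    (∀ j k : Fin n, j < k →
      expI ϑ (opS j k) =
        expI (Real.tan (ϑ / 4)) (momOp j ∘L momOp k) ∘L
        expI (Real.sin (ϑ / 2)) (posOp j ∘L posOp k) ∘L
        expI (Real.tan (ϑ / 4)) (momOp j ∘L momOp k)) ∧
    (∀ j k : Fin n, j < k →
      expI φ (opA j k) =
        expI (-Real.tan (φ / 4)) (posOp j ∘L momOp k) ∘L
        expI (Real.sin (φ / 2)) (momOp j ∘L posOp k) ∘L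
        expI (-Real.tan (φ / 4)) (posOp j ∘L momOp k)) := by
  have hpi := Real.pi_pos
  have hne (i i' : Fin n) (h : (i' : ℕ) = i + 1) : i ≠ i' := by grind
  obtain ⟨hsq, hE, hEH, hH, hS, hA⟩ := lemma1_general n ς ϑ φ ((abs_le.2 hς).trans_lt (by linarith))
    ((abs_le.2 hϑ).trans_lt (by linarith)) ((abs_le.2 hφ).trans_lt (by linarith))
  exact ⟨hsq, fun j k h => hE j k h.ne, fun i i' h => hEH i i' (hne i i' h),
    fun i i' h => hH i i' (hne i i' h), fun j k h => hS j k h.ne, fun j k h => hA j k h.ne⟩
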